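/- All oriented graphs are finite, have no loops, and have at most one arc between any two vertices. For an oriented graph $D$ and $X\subseteq V(D)$, the inversion of $X$ in $D$ is the oriented graph obtained by reversing every arc with both ends in $X$. The inversion number $\mathrm{inv}(D)$ is the smallest integer $m\ge 0$ such that there are sets $X_1,\dots,X_m\subseteq V(D)$ whose successive inversion turns $D$ into an oriented graph with no directed cycle. The dijoin $D_1\rightarrow D_2$ is the disjoint union of $D_1$ and $D_2$ together with an arc from $u$ to $v$ for all $u\in V(D_1)$, $v\in V(D_2)$. Let $\overrightarrow{C_3}$ be the directed cycle on three vertices. Theorem. Let $D_1$ and $D_2$ be oriented graphs with $\mathrm{inv}(D_1)=2$ and $\mathrm{inv}(D_2)=k$. Then either 1. $\mathrm{inv}(D_1\rightarrow D_2)=k+2$; or 2. $\mathrm{inv}(D_1\rightarrow D_2)=k+1$, in which case $k$ is odd. Moreover, $\mathrm{inv}(D_1\rightarrow D_2)=k+1$ if and only if $\mathrm{inv}(\overrightarrow{C_3}\rightarrow D_2)=k$. In particular, if $k$ is even, then $\mathrm{inv}(D_1\rightarrow D_2)=\mathrm{inv}(D_1)+\mathrm{inv}(D_2)$. -/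

import Mathlib

/-- A simple oriented graph on the vertex set `V`: a directed graph with no loops and with at
most one arc between any two vertices (both are expressed by the asymmetry of the arc relation). -/
structure OrientedGraph (V : Type*) extends Digraph V where
  asymm : ∀ u v : V, Adj u v → ¬ Adj v u

namespace OrientedGraph

/-- The inversion of `X` in `D`: every arc with both ends in `X` is reversed, every other arc is
kept. -/
def invert {V : Type*} (D : OrientedGraph V) (X : Set V) : OrientedGraph V where
  Adj u v := ((u ∈ X ∧ v ∈ X) ∧ D.Adj v u) ∨ (¬ (u ∈ X ∧ v ∈ X) ∧ D.Adj u v)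
  asymm u v := by
    have h₁ := D.asymm u v
    have h₂ := D.asymm v u
    tauto

/-- The inversion of a collection of sets: the sets are inverted successively. -/
def invertFamily {V : Type*} (D : OrientedGraph V) (L : List (Set V)) : OrientedGraph V :=
  L.foldl invert D

/-- An oriented graph is acyclic if it has no directed cycle, that is, if no vertex can be reached
from itself along a nonempty sequence of arcs. -/
def IsAcyclic {V : Type*} (D : OrientedGraph V) : Prop :=
  ∀ v : V, ¬ Relation.TransGen D.Adj v v

/-- The collection `L` is a decycling family for `D` if its inversion has no directed cycle. -/
def IsDecyclingFamily {V : Type*} (D : OrientedGraph V) (L : List (Set V)) : Prop :=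
  (D.invertFamily L).IsAcyclic

/-- The inversion number of `D`: the smallest `m` such that `D` has a decycling family of `m`
sets. (For finite `V` such an `m` exists, see `exists_isDecyclingFamily`.) -/
noncomputable def inv {V : Type*} (D : OrientedGraph V) : ℕ :=
  sInf {m : ℕ | ∃ L : List (Set V), L.length = m ∧ D.IsDecyclingFamily L}

/-- The dijoin `D₁ → D₂`: the disjoint union of `D₁` and `D₂` together with an arc from each vertex
of `D₁` to each vertex of `D₂`. -/
def dijoin {V W : Type*} (D₁ : OrientedGraph V) (D₂ : OrientedGraph W) :
    OrientedGraph (V ⊕ W) where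
  Adj x y := match x, y with
    | Sum.inl u, Sum.inl u' => D₁.Adj u u'
    | Sum.inl _, Sum.inr _ => True
    | Sum.inr _, Sum.inl _ => False
    | Sum.inr w, Sum.inr w' => D₂.Adj w w'
  asymm x y := match x, y with
    | Sum.inl u, Sum.inl u' => D₁.asymm u u'
    | Sum.inl _, Sum.inr _ => fun _ h => h
    | Sum.inr _, Sum.inl _ => fun h _ => h
    | Sum.inr w, Sum.inr w' => D₂.asymm w w'

/-- The directed cycle on three vertices, with arcs `0 → 1 → 2 → 0`. -/
def directedTriangle : OrientedGraph (Fin 3) where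
  Adj i j := j = i + 1
  asymm := by decide

/-- A finite oriented graph has a decycling family, so that its inversion number is an honest
minimum. -/
theorem exists_isDecyclingFamily {V : Type*} [Finite V] (D : OrientedGraph V) :
    ∃ L : List (Set V), D.IsDecyclingFamily L := by
  obtain ⟨n, ⟨e⟩⟩ := Finite.exists_equiv_fin V
  suffices H : ∀ (N : ℕ) (D : OrientedGraph V),
      {p : V × V | D.Adj p.1 p.2 ∧ e p.2 < e p.1}.ncard = N →
        ∃ L : List (Set V), D.IsDecyclingFamily L from H _ D rfl
  intro N
  induction N using Nat.strong_induction_on with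
  | _ N ih =>
    intro D hN
    by_cases hb : ∃ u v, D.Adj u v ∧ e v < e u
    · obtain ⟨u, v, huv, hlt⟩ := hb
      have hsub : {p : V × V | (D.invert {u, v}).Adj p.1 p.2 ∧ e p.2 < e p.1} ⊂
          {p : V × V | D.Adj p.1 p.2 ∧ e p.2 < e p.1} := by
        have hnot := D.asymm u v huv
        refine ⟨?_, fun h => ?_⟩
        · rintro ⟨a, b⟩ ⟨h, hab⟩
          refine ⟨?_, hab⟩
          rcases h with ⟨⟨ha, hb⟩, h⟩ | ⟨_, h⟩
          · simp only [Set.mem_insert_iff, Set.mem_singleton_iff] at ha hb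
            rcases ha with rfl | rfl <;> rcases hb with rfl | rfl
            · exact h
            · exact huv
            · exact absurd hab (by simpa using hlt.le)
            · exact h
          · exact h
        · have := (h (show (u, v) ∈ _ from ⟨huv, hlt⟩)).1
          simp [invert, hnot] at this
      obtain ⟨L, hL⟩ := ih _ (hN ▸ Set.ncard_lt_ncard hsub (Set.toFinite _)) _ rfl
      exact ⟨{u, v} :: L, hL⟩
    · push Not at hb
      refine ⟨[], fun v hv => ?_⟩
      have key : ∀ a b, Relation.TransGen D.Adj a b → e a < e b := by
        intro a b h
        have step : ∀ a b, D.Adj a b → e a < e b := fun a b h =>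
          lt_of_le_of_ne (hb a b h) fun hab => by
            have := e.injective hab
            subst this
            exact D.asymm _ _ h h
        induction h with
        | single h => exact step _ _ h
        | tail _ h ih => exact ih.trans (step _ _ h)
      exact lt_irrefl _ (key v v hv)

end OrientedGraph

/-! Encode `m` sets by one vector of `F₂^m` per vertex. An arc is reversed exactly when its ends
have dot product 1, so a decycling family amounts to a Gram matrix with a compatible linear order.

In a decycled dijoin, a vertex `u` of `D₁` and a vertex `w` of `D₂` have product 1 exactly when `w`
precedes `u`. Hence each `u` cuts an initial segment `f` out of the order of `D₂`, and these
segments are nested. Projecting the vectors of `D₂` orthogonally to that of `u` (if odd) adds `f i *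
f j` to the Gram matrix, and reversing the interval `f` compensates for this. So `D₂` is also
decycled by vectors in an orthogonal complement, which usually fit into fewer coordinates.

If two vertices of `D₁` span a nondegenerate plane, two coordinates are saved, or one is saved and
what remains is an odd number of coordinates with all vectors even. Otherwise the Gram matrix of
`D₁` is `c u * c v`, forcing `inv D₁ ≤ 1` (`IsOrderedBy.trichotomy`).

Both equalities of the theorem thus reduce to `HasEvenDecycling` with `k = inv D₂`. Conversely, the
all-ones vector is then odd and orthogonal to all of `D₂`, so it carries one set of `D₁`, or the
single set needed by the triangle, at no cost. -/

namespace OrientedGraph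

open Matrix

/-- Every arc `u → v` of `D` is forward in `r` if `c u v = 0`, and backward if `c u v = 1`. -/
def IsOrderedBy {V : Type*} (D : OrientedGraph V) (c : V → V → ZMod 2) (r : V → V → Prop) : Prop :=
  ∀ u v, D.Adj u v → (c u v = 0 → r u v) ∧ (c u v = 1 → r v u)

theorem zmod_two_cases (a : ZMod 2) : a = 0 ∨ a = 1 := by
  revert a; decide

theorem zmod_two_add_self (a : ZMod 2) : a + a = 0 := by
  revert a; decide

theorem zmod_two_mul_self (a : ZMod 2) : a * a = a := by
  revert a; decide

/-! ### Decycling families as Gram matrices over `ZMod 2` -/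

section Decycling

variable {V : Type*}

/-- An arc is reversed once for each set containing both ends; the dot product is the parity of that
number. -/
theorem adj_invertFamily_ofFn (m : ℕ) (D : OrientedGraph V) (y : V → Fin m → ZMod 2) (u v : V) :
    (D.invertFamily (List.ofFn fun i => {v | y v i = 1})).Adj u v ↔
      (y u ⬝ᵥ y v = 0 ∧ D.Adj u v) ∨ (y u ⬝ᵥ y v = 1 ∧ D.Adj v u) := by
  induction m generalizing D with
  | zero => simp [invertFamily]
  | succ m ih =>
    have h := ih (D.invert {v | y v 0 = 1}) (fun v i => y v i.succ)
    simp only [invertFamily, List.ofFn_succ, List.foldl_cons] at h ⊢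
    rw [h]
    simp only [dotProduct, Fin.sum_univ_succ, invert, Set.mem_ofPred_eq]
    generalize ∑ i : Fin m, y u i.succ * y v i.succ = s
    rcases zmod_two_cases (y u 0) with hu | hu <;> rcases zmod_two_cases (y v 0) with hv | hv <;>
      rcases zmod_two_cases s with hs | hs <;> simp [hu, hv, hs, show (1 : ZMod 2) + 1 = 0 from rfl]

theorem exists_ofFn_eq (L : List (Set V)) :
    ∃ y : V → Fin L.length → ZMod 2, L = List.ofFn fun i => {v | y v i = 1} := by
  classical
  refine ⟨fun v i => if v ∈ L.get i then 1 else 0, ?_⟩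
  conv_lhs => rw [← List.ofFn_get L]
  congr 1
  ext i v
  simp

theorem inv_le_card {ι : Type*} [Fintype ι] (D : OrientedGraph V) (y : V → ι → ZMod 2)
    (r : V → V → Prop) (hi : ∀ v, ¬ r v v) (ht : ∀ u v w, r u v → r v w → r u w)
    (h : D.IsOrderedBy (fun u v => y u ⬝ᵥ y v) r) : D.inv ≤ Fintype.card ι := by
  let e := Fintype.equivFin ι
  refine Nat.sInf_le ⟨List.ofFn fun i => {v | y v (e.symm i) = 1}, by simp, fun v hv => ?_⟩
  have hstep : ∀ u v, (D.invertFamily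
      (List.ofFn fun i => {v | y v (e.symm i) = 1})).Adj u v → r u v := by
    intro u v huv
    rw [adj_invertFamily_ofFn _ _ (fun v i => y v (e.symm i))] at huv
    have hs : ∀ u v, (fun i => y u (e.symm i)) ⬝ᵥ (fun i => y v (e.symm i)) = y u ⬝ᵥ y v :=
      fun u v => Equiv.sum_comp e.symm fun i => y u i * y v i
    rw [hs] at huv
    rcases huv with ⟨h0, ha⟩ | ⟨h1, ha⟩
    · exact (h _ _ ha).1 h0
    · exact (h _ _ ha).2 ((dotProduct_comm _ _).trans h1)
  have key : ∀ a b, Relation.TransGen (D.invertFamily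
      (List.ofFn fun i => {v | y v (e.symm i) = 1})).Adj a b → r a b := by
    intro a b hab
    induction hab with
    | single h => exact hstep _ _ h
    | tail _ h ih => exact ht _ _ _ ih (hstep _ _ h)
  exact hi v (key v v hv)

theorem exists_isOrderedBy [Finite V] (D : OrientedGraph V) :
    ∃ (y : V → Fin D.inv → ZMod 2) (r : V → V → Prop), (∀ v, ¬ r v v) ∧
      (∀ u v w, r u v → r v w → r u w) ∧ (∀ u v, r u v ∨ u = v ∨ r v u) ∧
      D.IsOrderedBy (fun u v => y u ⬝ᵥ y v) r := by
  have hne : {m : ℕ | ∃ L : List (Set V), L.length = m ∧ D.IsDecyclingFamily L}.Nonempty :=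
    let ⟨L, hL⟩ := D.exists_isDecyclingFamily
    ⟨_, L, rfl, hL⟩
  obtain ⟨L, hlen, hL⟩ := Nat.sInf_mem hne
  change L.length = D.inv at hlen
  rw [← hlen]
  obtain ⟨y, hy⟩ := exists_ofFn_eq L
  let A := (D.invertFamily L).Adj
  have hpo : IsPartialOrder V (Relation.ReflTransGen A) :=
    { refl := fun _ => Relation.ReflTransGen.refl
      trans := fun _ _ _ => Relation.ReflTransGen.trans
      antisymm := fun a b hab hba => by
        rcases Relation.reflTransGen_iff_eq_or_transGen.1 hab with h | h
        · exact h.symm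
        · exact absurd (h.trans_left hba) (hL a) }
  -- A linear extension of reachability makes intervals and initial segments available.
  obtain ⟨s, hs, hle⟩ := extend_partialOrder (Relation.ReflTransGen A)
  have hA : ∀ u v, A u v → s u v ∧ u ≠ v := fun u v h =>
    ⟨hle _ _ (Relation.ReflTransGen.single h), fun e => hL v (by subst e; exact .single h)⟩
  refine ⟨y, fun u v => s u v ∧ u ≠ v, fun v h => h.2 rfl, fun u v w h h' => ⟨hs.trans _ _ _ h.1 h'.1, ?_⟩,
    fun u v => ?_, fun u v huv => ⟨fun h0 => hA _ _ ?_, fun h1 => hA _ _ ?_⟩⟩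
  · rintro rfl
    exact h.2 (hs.antisymm _ _ h.1 h'.1)
  · by_cases e : u = v
    · exact Or.inr (Or.inl e)
    · exact (hs.total u v).imp (fun h => ⟨h, e⟩) fun h => Or.inr ⟨h, Ne.symm e⟩
  · have := (adj_invertFamily_ofFn _ D y u v).2 (Or.inl ⟨h0, huv⟩)
    rwa [← hy] at this
  · have := (adj_invertFamily_ofFn _ D y v u).2
      (Or.inr ⟨by rw [dotProduct_comm]; exact h1, huv⟩)
    rwa [← hy] at this

end Decycling

/-! ### Reversing intervals of a linear order -/

section Reordering

variable {W : Type*}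

/-- The relation obtained from `r` by reversing all pairs with `δ = 1`. -/
def flipRel (r : W → W → Prop) (δ : W → W → ZMod 2) (i j : W) : Prop :=
  (δ i j = 0 ∧ r i j) ∨ (δ i j = 1 ∧ r j i)

theorem IsOrderedBy.flipRel {D : OrientedGraph W} {c c' δ : W → W → ZMod 2} {r : W → W → Prop}
    (h : D.IsOrderedBy c r) (hc : ∀ i j, c' i j = c i j + δ i j) (hδ : ∀ i j, δ i j = δ j i) :
    D.IsOrderedBy c' (flipRel r δ) := by
  intro u v huv
  obtain ⟨h0, h1⟩ := h u v huv
  unfold OrientedGraph.flipRel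
  rw [hc, hδ v u]
  rcases zmod_two_cases (c u v) with e | e <;> rcases zmod_two_cases (δ u v) with e' | e' <;>
    simp [e, e', show (1 : ZMod 2) + 1 = 0 from rfl, h0, h1]

/-- A set, given by its indicator `h`, is an interval of the relation `r`. -/
def IsInterval (r : W → W → Prop) (h : W → ZMod 2) : Prop :=
  ∀ i j k, r i j → r j k → h i = 1 → h k = 1 → h j = 1

/-- Two sets, given by their indicators, are nested or disjoint. -/
def IsLaminar (h h' : W → ZMod 2) : Prop :=
  (∀ i, h i = 1 → h' i = 1) ∨ (∀ i, h' i = 1 → h i = 1) ∨ ∀ i, h i = 1 → h' i = 0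

theorem flipRel_mul_iff (r : W → W → Prop) (h : W → ZMod 2) (i j : W) :
    flipRel r (fun i j => h i * h j) i j ↔
      (h i = 1 ∧ h j = 1 ∧ r j i) ∨ (¬ (h i = 1 ∧ h j = 1) ∧ r i j) := by
  unfold flipRel
  rcases zmod_two_cases (h i) with a | a <;> rcases zmod_two_cases (h j) with b | b <;> simp [a, b]

/-- A vertex outside an interval lies on the same side of all its members, so reversing the interval
creates no cycle. -/
theorem IsInterval.isStrictTotalOrder_flipRel {r : W → W → Prop} [IsStrictTotalOrder W r]
    {h : W → ZMod 2} (hr : IsInterval r h) :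
    IsStrictTotalOrder W (flipRel r fun i j => h i * h j) where
  trichotomous i j hij hji := by
    rw [flipRel_mul_iff] at hij hji
    rcases trichotomous_of r i j with e | e | e
    · tauto
    · exact e
    · tauto
  irrefl i hi := by
    rw [flipRel_mul_iff] at hi
    have := irrefl_of r i
    tauto
  trans i j k hij hjk := by
    rw [flipRel_mul_iff] at hij hjk ⊢
    have h1 := hr i j k
    have h2 := hr k j i
    have h3 := hr j k i
    have h4 := hr k i j
    have t1 : r i j → r j k → r i k := trans_of r
    have t2 : r k j → r j i → r k i := trans_of r
    have t3 : r i k ∨ i = k ∨ r k i := trichotomous_of r i k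
    have t4 : ¬ r i i := irrefl_of r i
    by_cases a : h i = 1 <;> by_cases b : h j = 1 <;> by_cases c : h k = 1 <;>
      simp only [a, b, c, true_and, false_and, and_false, and_true, not_true_eq_false,
        not_false_eq_true, or_false, false_or, imp_false, forall_const] at hij hjk h1 h2 h3 h4 ⊢ <;>
      grind

theorem IsInterval.flipRel {r : W → W → Prop} {h h' : W → ZMod 2} (hr : IsInterval r h')
    (hl : IsLaminar h h') : IsInterval (flipRel r fun i j => h i * h j) h' := by
  intro i j k hij hjk hi hk
  rw [flipRel_mul_iff] at hij hjk
  have h1 := hr i j k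
  have h2 := hr k j i
  by_contra hj
  rcases hl with hl | hl | hl
  · have := hl j
    tauto
  · have := hl i hi
    have := hl k hk
    tauto
  · have e : ¬ h i = 1 := fun e => by simp [hl i e] at hi
    have e' : ¬ h k = 1 := fun e => by simp [hl k e] at hk
    tauto

/-- The indicator `f` describes a set that is downward closed for `r`. -/
def IsInitial (r : W → W → Prop) (f : W → ZMod 2) : Prop :=
  ∀ i j, r i j → f j = 1 → f i = 1

theorem IsInitial.isInterval {r : W → W → Prop} {f : W → ZMod 2} (hf : IsInitial r f) :
    IsInterval r f := fun _ _ _ _ hjk _ hk => hf _ _ hjk hk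

theorem IsInitial.nested {r : W → W → Prop} [IsStrictTotalOrder W r] {f g : W → ZMod 2}
    (hf : IsInitial r f) (hg : IsInitial r g) :
    (∀ i, f i = 1 → g i = 1) ∨ ∀ i, g i = 1 → f i = 1 := by
  by_contra! hc
  obtain ⟨⟨i, hi, hi'⟩, j, hj, hj'⟩ := hc
  rcases trichotomous_of r i j with e | e | e
  · exact hi' (hg _ _ e hj)
  · subst e; exact hi' hj
  · exact hj' (hf _ _ e hi)

theorem IsInitial.isInterval_add {r : W → W → Prop} [IsStrictTotalOrder W r] {f g : W → ZMod 2}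
    (hf : IsInitial r f) (hg : IsInitial r g) : IsInterval r fun i => f i + g i := by
  intro i j k hij hjk hi hk
  have h1 := hf i j hij
  have h2 := hf j k hjk
  have h3 := hg i j hij
  have h4 := hg j k hjk
  beta_reduce at hi hk ⊢
  rcases zmod_two_cases (f k) with a | a <;> rcases zmod_two_cases (g k) with b | b
  · simp [a, b] at hk
  · rcases zmod_two_cases (f j) with c | c
    · simp [c, h4 b]
    · simp [h1 c, h3 (h4 b), zmod_two_add_self] at hi
  · rcases zmod_two_cases (g j) with c | c
    · simp [c, h2 a]
    · simp [h1 (h2 a), h3 c, zmod_two_add_self] at hi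
  · simp [a, b, zmod_two_add_self] at hk

theorem isLaminar_add {f g : W → ZMod 2}
    (h : (∀ i, f i = 1 → g i = 1) ∨ ∀ i, g i = 1 → f i = 1) :
    IsLaminar f fun i => f i + g i := by
  have k1 : ∀ a b : ZMod 2, (a = 1 → b = 1) → a = 1 → a + b = 0 := by decide
  have k2 : ∀ a b : ZMod 2, (b = 1 → a = 1) → a + b = 1 → a = 1 := by decide
  rcases h with h | h
  · exact Or.inr (Or.inr fun i => k1 _ _ (h i))
  · exact Or.inr (Or.inl fun i => k2 _ _ (h i))

end Reordering

/-! ### Changes of the Gram matrix absorbed by reversals -/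

section Reversals

variable {W : Type*}

theorem IsOrderedBy.exists_add_mul {D : OrientedGraph W} {c : W → W → ZMod 2} {r : W → W → Prop}
    [IsStrictTotalOrder W r] (h : D.IsOrderedBy c r) {f : W → ZMod 2} (hf : IsInterval r f) :
    ∃ r' : W → W → Prop, IsStrictTotalOrder W r' ∧
      D.IsOrderedBy (fun i j => c i j + f i * f j) r' ∧
      ∀ g, IsLaminar f g → IsInterval r g → IsInterval r' g :=
  ⟨_, hf.isStrictTotalOrder_flipRel, h.flipRel (fun _ _ => rfl) fun _ _ => mul_comm _ _,
    fun _ hl hg => hg.flipRel hl⟩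

variable {D : OrientedGraph W} {c : W → W → ZMod 2} {r : W → W → Prop} [IsStrictTotalOrder W r]
  {f g : W → ZMod 2}

theorem IsOrderedBy.exists_reverse_reverse (h : D.IsOrderedBy c r) (hf : IsInitial r f)
    (hg : IsInitial r g) : ∃ r' : W → W → Prop, IsStrictTotalOrder W r' ∧
      D.IsOrderedBy (fun i j => c i j + f i * f j + g i * g j) r' := by
  obtain ⟨r₁, _, h₁, hr₁⟩ := h.exists_add_mul hf.isInterval
  have hl : IsLaminar f g := (hf.nested hg).imp_right Or.inl
  obtain ⟨r₂, hs, h₂, -⟩ := h₁.exists_add_mul (hr₁ g hl hg.isInterval)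
  exact ⟨r₂, hs, h₂⟩

theorem IsOrderedBy.exists_reverse_reverse_add (h : D.IsOrderedBy c r) (hf : IsInitial r f)
    (hg : IsInitial r g) : ∃ r' : W → W → Prop, IsStrictTotalOrder W r' ∧
      D.IsOrderedBy (fun i j => c i j + f i * f j + (f i + g i) * (f j + g j)) r' := by
  obtain ⟨r₁, _, h₁, hr₁⟩ := h.exists_add_mul hf.isInterval
  obtain ⟨r₂, hs, h₂, -⟩ :=
    h₁.exists_add_mul (hr₁ _ (isLaminar_add (hf.nested hg)) (hf.isInterval_add hg))
  exact ⟨r₂, hs, h₂⟩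

/-- Modulo 2 the added term is `(f + g)(f + g) + f f + g g`, so three reversals of pairwise laminar
intervals suffice. -/
theorem IsOrderedBy.exists_swap (h : D.IsOrderedBy c r) (hf : IsInitial r f)
    (hg : IsInitial r g) : ∃ r' : W → W → Prop, IsStrictTotalOrder W r' ∧
      D.IsOrderedBy (fun i j => c i j + (f i * g j + g i * f j)) r' := by
  obtain ⟨r₁, _, h₁, hr₁⟩ := h.exists_add_mul (hf.isInterval_add hg)
  have hl : ∀ {f g : W → ZMod 2}, ((∀ i, f i = 1 → g i = 1) ∨ ∀ i, g i = 1 → f i = 1) →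
      IsLaminar (fun i => f i + g i) f := by
    intro f g hfg
    rcases isLaminar_add hfg with h | h | h
    · exact Or.inr (Or.inl h)
    · exact Or.inl h
    · exact Or.inr (Or.inr fun i hi => (zmod_two_cases (f i)).resolve_right
        fun e => by simp [h i e] at hi)
  have hlf := hl (hf.nested hg)
  have hlg := hl (hf.nested hg).symm
  simp only [add_comm (g _)] at hlg
  obtain ⟨r₂, _, h₂, hr₂⟩ := h₁.exists_add_mul (hr₁ f hlf hf.isInterval)
  obtain ⟨r₃, hs, h₃, -⟩ := h₂.exists_add_mul
    (hr₂ g ((hf.nested hg).imp_right Or.inl) (hr₁ g hlg hg.isInterval))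
  refine ⟨r₃, hs, ?_⟩
  convert h₃ using 3 with i j
  generalize c i j = c
  linear_combination (-(f i * f j) - g i * g j) * (CharTwo.two_eq_zero : (2 : ZMod 2) = 0)

end Reversals

/-! ### Orthogonal complements in fewer coordinates -/

section Forms

variable {ι : Type} [Fintype ι]

theorem dotProduct_self_eq_dotProduct_one (x : ι → ZMod 2) : x ⬝ᵥ x = x ⬝ᵥ 1 := by
  simp [dotProduct, zmod_two_mul_self]

theorem dotProduct_subtype_ne [DecidableEq ι] (i : ι) (u v : ι → ZMod 2) :
    (fun l : {l // l ≠ i} => u l) ⬝ᵥ (fun l : {l // l ≠ i} => v l) = u ⬝ᵥ v - u i * v i := by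
  rw [eq_sub_iff_add_eq, add_comm]
  simp only [dotProduct]
  exact (Fintype.sum_eq_add_sum_subtype_ne (fun l => u l * v l) i).symm

theorem card_subtype_ne [DecidableEq ι] (i : ι) :
    Fintype.card {l // l ≠ i} + 1 = Fintype.card ι := by
  have := Fintype.card_pos_iff.2 ⟨i⟩
  simp [Fintype.card_subtype_compl]
  omega

theorem exists_eq_zero {x : ι → ZMod 2} (hx : x ≠ 1) : ∃ i, x i = 0 := by
  by_contra! h
  exact hx (funext fun i => (zmod_two_cases _).resolve_left (h i))

/-- The coordinate `i` with `x i = 0` can be deleted after the transvection along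
`x + Pi.single i 1`, which maps `x` to `Pi.single i 1` if `x` is odd. -/
theorem dotProduct_transvection [DecidableEq ι] {x : ι → ZMod 2} {i : ι} (hi : x i = 0)
    (hx : x ⬝ᵥ x = 1) {u v : ι → ZMod 2} (hu : u ⬝ᵥ x = 0) (hv : v ⬝ᵥ x = 0) :
    (fun l : {l // l ≠ i} => u l + u i * x l) ⬝ᵥ (fun l : {l // l ≠ i} => v l + v i * x l) =
      u ⬝ᵥ v := by
  have h := dotProduct_subtype_ne i (u + u i • x) (v + v i • x)
  simp only [Pi.add_apply, Pi.smul_apply, smul_eq_mul] at h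
  rw [h]
  have hv' : x ⬝ᵥ v = 0 := by rw [dotProduct_comm]; exact hv
  simp [add_dotProduct, dotProduct_add, hx, hu, hv', hi]
  ring

theorem exists_delete_coordinate {W : Type*} {x : ι → ZMod 2} (hx : x ⬝ᵥ x = 1) (hx1 : x ≠ 1)
    (y : W → ι → ZMod 2) (hy : ∀ w, y w ⬝ᵥ x = 0) :
    ∃ (κ : Type) (_ : Fintype κ) (y' : W → κ → ZMod 2), Fintype.card κ + 1 = Fintype.card ι ∧
      ∀ v w, y' v ⬝ᵥ y' w = y v ⬝ᵥ y w := by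
  classical
  obtain ⟨i, hi⟩ := exists_eq_zero hx1
  exact ⟨_, inferInstance, _, card_subtype_ne i,
    fun v w => dotProduct_transvection hi hx (hy v) (hy w)⟩

/-- Orthogonality to an even vector `x ≠ 0, 1` saves two coordinates. -/
theorem exists_delete_two_coordinates {W : Type*} {x : ι → ZMod 2} (hx : x ⬝ᵥ x = 0) (hx0 : x ≠ 0)
    (hx1 : x ≠ 1) (y : W → ι → ZMod 2) (hy : ∀ w, y w ⬝ᵥ x = 0) :
    ∃ (κ : Type) (_ : Fintype κ) (y' : W → κ → ZMod 2), Fintype.card κ + 2 = Fintype.card ι ∧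
      ∀ v w, y' v ⬝ᵥ y' w = y v ⬝ᵥ y w := by
  classical
  obtain ⟨j, hj⟩ := exists_eq_zero hx1
  obtain ⟨i, hi⟩ := Function.ne_iff.1 hx0
  replace hi : x i = 1 := (zmod_two_cases _).resolve_left hi
  have hij : j ≠ i := by rintro rfl; rw [hi] at hj; exact one_ne_zero hj
  -- The transvection along the even vector `n = x + e_i + e_j`, where `y w ⬝ᵥ n = y w i + y w j`.
  -- It maps `x` to `e_i + e_j`, so images have equal coordinates `i` and `j`, whose contributions
  -- cancel.
  let t : W → ι → ZMod 2 := fun w => y w + (y w i + y w j) • (x + Pi.single i 1 + Pi.single j 1)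
  have ht : ∀ v w, t v ⬝ᵥ t w = y v ⬝ᵥ y w := by
    intro v w
    have hv' : x ⬝ᵥ y w = 0 := by rw [dotProduct_comm]; exact hy w
    simp [t, add_dotProduct, dotProduct_add, hx, hy, hi, hj, hv', hij, hij.symm,
      zmod_two_add_self]
    linear_combination ((y v i + y v j) * (y w i + y w j) * 2) * (CharTwo.two_eq_zero : (2 : ZMod 2) = 0)
  have hti : ∀ w, t w i = y w i := fun w => by simp [t, hi, hij.symm, zmod_two_add_self]
  have htj : ∀ w, t w j = y w i := fun w => by
    simp [t, hj, hij]
    linear_combination (y w j) * (CharTwo.two_eq_zero : (2 : ZMod 2) = 0)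
  refine ⟨{l : {l // l ≠ i} // l ≠ ⟨j, hij⟩}, inferInstance, fun w l => t w l, ?_, fun v w => ?_⟩
  · rw [← card_subtype_ne i, ← card_subtype_ne (⟨j, hij⟩ : {l // l ≠ i})]
  · rw [dotProduct_subtype_ne (⟨j, hij⟩ : {l // l ≠ i}) (fun l => t v l) (fun l => t w l),
      dotProduct_subtype_ne i, ht, hti, hti, htj, htj]
    linear_combination (-(y v i * y w i)) * (CharTwo.two_eq_zero : (2 : ZMod 2) = 0)

/-- After `e₁` is split off, the image of `e₂` is still odd and can be split off too, unless it is
the all-ones vector. In that case the dimension is odd, and orthogonality to it means evenness. -/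
theorem exists_delete_orthonormal_pair {W : Type*} {e₁ e₂ : ι → ZMod 2} (h₁ : e₁ ⬝ᵥ e₁ = 1)
    (h₂ : e₂ ⬝ᵥ e₂ = 1) (h₁₂ : e₂ ⬝ᵥ e₁ = 0) (y : W → ι → ZMod 2) (hy₁ : ∀ w, y w ⬝ᵥ e₁ = 0)
    (hy₂ : ∀ w, y w ⬝ᵥ e₂ = 0) :
    (∃ (κ : Type) (_ : Fintype κ) (y' : W → κ → ZMod 2), Fintype.card κ + 2 = Fintype.card ι ∧
      ∀ v w, y' v ⬝ᵥ y' w = y v ⬝ᵥ y w) ∨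
    ∃ (κ : Type) (_ : Fintype κ) (y' : W → κ → ZMod 2), Fintype.card κ + 1 = Fintype.card ι ∧
      Odd (Fintype.card κ) ∧ (∀ w, y' w ⬝ᵥ y' w = 0) ∧ ∀ v w, y' v ⬝ᵥ y' w = y v ⬝ᵥ y w := by
  classical
  have hne : e₁ ≠ 1 := by
    rintro rfl
    rw [← dotProduct_self_eq_dotProduct_one, h₂] at h₁₂
    exact one_ne_zero h₁₂
  obtain ⟨i, hi⟩ := exists_eq_zero hne
  let τ : (ι → ZMod 2) → {l // l ≠ i} → ZMod 2 := fun u l => u l + u i * e₁ l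
  have hτ : ∀ {u v : ι → ZMod 2}, u ⬝ᵥ e₁ = 0 → v ⬝ᵥ e₁ = 0 → τ u ⬝ᵥ τ v = u ⬝ᵥ v :=
    fun hu hv => dotProduct_transvection hi h₁ hu hv
  have hξ : τ e₂ ⬝ᵥ τ e₂ = 1 := (hτ h₁₂ h₁₂).trans h₂
  by_cases hξ1 : τ e₂ = 1
  · refine Or.inr ⟨_, inferInstance, fun w => τ (y w), card_subtype_ne i, ?_, fun w => ?_,
      fun v w => hτ (hy₁ v) (hy₁ w)⟩
    · rw [hξ1] at hξ
      rw [← ZMod.natCast_eq_one_iff_odd, ← hξ]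
      simp [dotProduct]
    · rw [dotProduct_self_eq_dotProduct_one, ← hξ1, hτ (hy₁ w) h₁₂, hy₂]
  · obtain ⟨κ, _, y', hc, hy'⟩ := exists_delete_coordinate hξ hξ1 (fun w => τ (y w))
      fun w => (hτ (hy₁ w) h₁₂).trans (hy₂ w)
    refine Or.inl ⟨κ, inferInstance, y', ?_, fun v w => (hy' v w).trans (hτ (hy₁ v) (hy₁ w))⟩
    rw [← card_subtype_ne i, ← hc]

end Forms

/-- `D` has a decycling family of `k` sets, `k` odd, such that each vertex lies in an even number
of the sets. -/
def HasEvenDecycling {W : Type*} (D : OrientedGraph W) (k : ℕ) : Prop :=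
  Odd k ∧ ∃ (κ : Type) (_ : Fintype κ) (y : W → κ → ZMod 2) (r : W → W → Prop),
    Fintype.card κ = k ∧ IsStrictTotalOrder W r ∧ D.IsOrderedBy (fun v w => y v ⬝ᵥ y w) r ∧
      ∀ w, y w ⬝ᵥ y w = 0

/-! ### Projecting a decycling of `D₂` -/

section Projection

variable {W : Type*} {ι : Type} [Fintype ι] {D : OrientedGraph W} {r : W → W → Prop}
  {y : W → ι → ZMod 2} {a b : ι → ZMod 2}

theorem IsOrderedBy.inv_le {κ : Type*} [Fintype κ] {z : W → κ → ZMod 2} [IsStrictTotalOrder W r]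
    (h : D.IsOrderedBy (fun v w => z v ⬝ᵥ z w) r) : D.inv ≤ Fintype.card κ :=
  D.inv_le_card z r (irrefl_of r) (fun _ _ _ => trans_of r) h

theorem IsOrderedBy.of_gram_eq {κ : Type*} [Fintype κ] {z : W → κ → ZMod 2} {c : W → W → ZMod 2}
    (h : D.IsOrderedBy c r) (hz : ∀ v w, z v ⬝ᵥ z w = c v w) :
    D.IsOrderedBy (fun v w => z v ⬝ᵥ z w) r := by
  rwa [show (fun v w => z v ⬝ᵥ z w) = c from funext₂ hz]

variable [IsStrictTotalOrder W r]

theorem inv_lt_card_of_orthogonal (h : D.IsOrderedBy (fun v w => y v ⬝ᵥ y w) r)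
    (ha : a ⬝ᵥ a = 1) (ha1 : a ≠ 1) (hy : ∀ w, y w ⬝ᵥ a = 0) : D.inv < Fintype.card ι := by
  obtain ⟨κ, _, z, hc, hz⟩ := exists_delete_coordinate ha ha1 y hy
  have := (h.of_gram_eq hz).inv_le
  omega

theorem inv_lt_card_of_odd (h : D.IsOrderedBy (fun v w => y v ⬝ᵥ y w) r)
    (hf : IsInitial r fun w => a ⬝ᵥ y w) (ha : a ⬝ᵥ a = 1) (ha1 : a ≠ 1) :
    D.inv < Fintype.card ι := by
  obtain ⟨r', _, h', -⟩ := h.exists_add_mul hf.isInterval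
  refine inv_lt_card_of_orthogonal (y := fun w => y w + (a ⬝ᵥ y w) • a) (a := a)
    (h'.of_gram_eq fun v w => ?_) ha ha1 fun w => ?_
  · simp only [add_dotProduct, dotProduct_add, smul_dotProduct, dotProduct_smul, smul_eq_mul, ha,
      dotProduct_comm _ a]
    linear_combination (a ⬝ᵥ y v) * (a ⬝ᵥ y w) * (CharTwo.two_eq_zero : (2 : ZMod 2) = 0)
  · simp [ha, dotProduct_comm _ a, zmod_two_add_self]

/-- Projection off the hyperbolic plane of `a` and `b` changes the Gram matrix by the swap term.
Orthogonality to the even vector `a` alone then saves both coordinates. -/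
theorem inv_add_two_le_of_even_pair (h : D.IsOrderedBy (fun v w => y v ⬝ᵥ y w) r)
    (hf : IsInitial r fun w => a ⬝ᵥ y w) (hg : IsInitial r fun w => b ⬝ᵥ y w)
    (ha : a ⬝ᵥ a = 0) (hb : b ⬝ᵥ b = 0) (hab : a ⬝ᵥ b = 1) : D.inv + 2 ≤ Fintype.card ι := by
  obtain ⟨r', _, h'⟩ := h.exists_swap hf hg
  have ha0 : a ≠ 0 := by
    rintro rfl
    simp at hab
  have ha1 : a ≠ 1 := by
    rintro rfl
    rw [dotProduct_comm, ← dotProduct_self_eq_dotProduct_one, hb] at hab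
    exact zero_ne_one hab
  have hba : b ⬝ᵥ a = 1 := (dotProduct_comm _ _).trans hab
  let t : W → ι → ZMod 2 := fun w => y w + (b ⬝ᵥ y w) • a + (a ⬝ᵥ y w) • b
  have ht : ∀ v w, t v ⬝ᵥ t w =
      y v ⬝ᵥ y w + ((a ⬝ᵥ y v) * (b ⬝ᵥ y w) + (b ⬝ᵥ y v) * (a ⬝ᵥ y w)) := by
    intro v w
    simp only [t, add_dotProduct, dotProduct_add, smul_dotProduct, dotProduct_smul, smul_eq_mul,
      ha, hb, hab, hba, dotProduct_comm (y _) a, dotProduct_comm (y _) b]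
    linear_combination ((a ⬝ᵥ y v) * (b ⬝ᵥ y w) + (b ⬝ᵥ y v) * (a ⬝ᵥ y w)) *
      (CharTwo.two_eq_zero : (2 : ZMod 2) = 0)
  obtain ⟨κ, _, z, hc, hz⟩ := exists_delete_two_coordinates ha ha0 ha1 t fun w => by
    simp [t, add_dotProduct, ha, hba, dotProduct_comm (y _) a, zmod_two_add_self]
  have := (h'.of_gram_eq fun v w => (hz v w).trans (ht v w)).inv_le
  omega

theorem inv_or_hasEvenDecycling_of_orthogonal (h : D.IsOrderedBy (fun v w => y v ⬝ᵥ y w) r)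
    (ha : a ⬝ᵥ a = 1) (hb : b ⬝ᵥ b = 1) (hab : b ⬝ᵥ a = 0) (hya : ∀ w, y w ⬝ᵥ a = 0)
    (hyb : ∀ w, y w ⬝ᵥ b = 0) :
    D.inv + 2 ≤ Fintype.card ι ∨ ∃ k, k + 1 = Fintype.card ι ∧ D.HasEvenDecycling k := by
  rcases exists_delete_orthonormal_pair ha hb hab y hya hyb with
    ⟨κ, _, z, hc, hz⟩ | ⟨κ, _, z, hc, ho, he, hz⟩
  · have := (h.of_gram_eq hz).inv_le
    exact Or.inl (by omega)
  · exact Or.inr ⟨_, hc, ho, κ, inferInstance, z, r, rfl, inferInstance, h.of_gram_eq hz, he⟩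

/-- Projecting `D` orthogonally to an orthonormal pair. -/
theorem gram_project {a b : ι → ZMod 2} (ha : a ⬝ᵥ a = 1) (hb : b ⬝ᵥ b = 1)
    (hab : a ⬝ᵥ b = 0) (u v : ι → ZMod 2) :
    (u + (a ⬝ᵥ u) • a + (b ⬝ᵥ u) • b) ⬝ᵥ (v + (a ⬝ᵥ v) • a + (b ⬝ᵥ v) • b) =
      u ⬝ᵥ v + (a ⬝ᵥ u) * (a ⬝ᵥ v) + (b ⬝ᵥ u) * (b ⬝ᵥ v) := by
  have hba : b ⬝ᵥ a = 0 := (dotProduct_comm _ _).trans hab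
  simp only [add_dotProduct, dotProduct_add, smul_dotProduct, dotProduct_smul, smul_eq_mul,
    ha, hb, hab, hba, dotProduct_comm u a, dotProduct_comm u b]
  linear_combination ((a ⬝ᵥ u) * (a ⬝ᵥ v) + (b ⬝ᵥ u) * (b ⬝ᵥ v)) *
    (CharTwo.two_eq_zero : (2 : ZMod 2) = 0)

theorem inv_or_hasEvenDecycling_of_orderedBy {r' : W → W → Prop} [IsStrictTotalOrder W r']
    (h : D.IsOrderedBy (fun v w => y v ⬝ᵥ y w + (a ⬝ᵥ y v) * (a ⬝ᵥ y w) +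
      (b ⬝ᵥ y v) * (b ⬝ᵥ y w)) r')
    (ha : a ⬝ᵥ a = 1) (hb : b ⬝ᵥ b = 1) (hab : a ⬝ᵥ b = 0) :
    D.inv + 2 ≤ Fintype.card ι ∨ ∃ k, k + 1 = Fintype.card ι ∧ D.HasEvenDecycling k := by
  have hba : b ⬝ᵥ a = 0 := (dotProduct_comm _ _).trans hab
  refine inv_or_hasEvenDecycling_of_orthogonal
    (h.of_gram_eq (z := fun w => y w + (a ⬝ᵥ y w) • a + (b ⬝ᵥ y w) • b)
      fun v w => gram_project ha hb hab (y v) (y w)) ha hb hba (fun w => ?_) fun w => ?_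
  · simp [add_dotProduct, ha, hba, dotProduct_comm (y _) a, zmod_two_add_self]
  · simp [add_dotProduct, hb, hab, dotProduct_comm (y _) b, zmod_two_add_self]

theorem inv_or_hasEvenDecycling_of_odd_odd (h : D.IsOrderedBy (fun v w => y v ⬝ᵥ y w) r)
    (hf : IsInitial r fun w => a ⬝ᵥ y w) (hg : IsInitial r fun w => b ⬝ᵥ y w)
    (ha : a ⬝ᵥ a = 1) (hb : b ⬝ᵥ b = 1) (hab : a ⬝ᵥ b = 0) :
    D.inv + 2 ≤ Fintype.card ι ∨ ∃ k, k + 1 = Fintype.card ι ∧ D.HasEvenDecycling k := by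
  obtain ⟨r', _, h'⟩ := h.exists_reverse_reverse hf hg
  exact inv_or_hasEvenDecycling_of_orderedBy h' ha hb hab

/-- The pair `a`, `a + b` is orthonormal, and `f + g` is still an interval. -/
theorem inv_or_hasEvenDecycling_of_odd_even (h : D.IsOrderedBy (fun v w => y v ⬝ᵥ y w) r)
    (hf : IsInitial r fun w => a ⬝ᵥ y w) (hg : IsInitial r fun w => b ⬝ᵥ y w)
    (ha : a ⬝ᵥ a = 1) (hb : b ⬝ᵥ b = 0) (hab : a ⬝ᵥ b = 1) :
    D.inv + 2 ≤ Fintype.card ι ∨ ∃ k, k + 1 = Fintype.card ι ∧ D.HasEvenDecycling k := by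
  obtain ⟨r', _, h'⟩ := h.exists_reverse_reverse_add hf hg
  have hba : b ⬝ᵥ a = 1 := (dotProduct_comm _ _).trans hab
  refine inv_or_hasEvenDecycling_of_orderedBy (r' := r') (a := a) (b := a + b) (y := y) ?_ ha ?_ ?_
  · simpa only [add_dotProduct] using h'
  · simp [ha, hb, hab, hba, zmod_two_add_self]
  · simp [ha, hab, zmod_two_add_self]

end Projection

/-! ### The order of a decycled dijoin -/

section Dijoin

variable {V W : Type*} {D₁ : OrientedGraph V} {D₂ : OrientedGraph W} {ι : Type} [Fintype ι]
  {z : V ⊕ W → ι → ZMod 2} {r : V ⊕ W → V ⊕ W → Prop}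

theorem isStrictTotalOrder_comap {α β : Type*} {e : α → β} (he : Function.Injective e)
    (s : β → β → Prop) [IsStrictTotalOrder β s] : IsStrictTotalOrder α fun a b => s (e a) (e b) where
  trichotomous a b h h' := by
    rcases trichotomous_of s (e a) (e b) with k | k | k
    · exact absurd k h
    · exact he k
    · exact absurd k h'
  irrefl a := irrefl_of s (e a)
  trans _ _ _ := trans_of s

theorem exists_isStrictTotalOrder [Finite V] (D : OrientedGraph V) :
    ∃ (y : V → Fin D.inv → ZMod 2) (r : V → V → Prop), IsStrictTotalOrder V r ∧
      D.IsOrderedBy (fun u v => y u ⬝ᵥ y v) r := by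
  obtain ⟨y, r, hi, ht, htot, h⟩ := D.exists_isOrderedBy
  exact ⟨y, r, { trichotomous := fun a b k k' => ((htot a b).resolve_left k).resolve_right k'
                 irrefl := hi
                 trans := ht }, h⟩

theorem IsOrderedBy.left (h : (D₁.dijoin D₂).IsOrderedBy (fun u v => z u ⬝ᵥ z v) r) :
    D₁.IsOrderedBy (fun u v => z (.inl u) ⬝ᵥ z (.inl v)) fun u v => r (.inl u) (.inl v) :=
  fun u v huv => h (.inl u) (.inl v) huv

theorem IsOrderedBy.right (h : (D₁.dijoin D₂).IsOrderedBy (fun u v => z u ⬝ᵥ z v) r) :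
    D₂.IsOrderedBy (fun u v => z (.inr u) ⬝ᵥ z (.inr v)) fun u v => r (.inr u) (.inr v) :=
  fun u v huv => h (.inr u) (.inr v) huv

variable [IsStrictTotalOrder (V ⊕ W) r]

theorem IsOrderedBy.dotProduct_eq_one_iff
    (h : (D₁.dijoin D₂).IsOrderedBy (fun u v => z u ⬝ᵥ z v) r) (u : V) (w : W) :
    z (.inl u) ⬝ᵥ z (.inr w) = 1 ↔ r (.inr w) (.inl u) := by
  obtain ⟨h0, h1⟩ := h (.inl u) (.inr w) trivial
  refine ⟨h1, fun hr => (zmod_two_cases _).resolve_left fun e => ?_⟩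
  exact irrefl_of r _ (trans_of r hr (h0 e))

theorem IsOrderedBy.isInitial (h : (D₁.dijoin D₂).IsOrderedBy (fun u v => z u ⬝ᵥ z v) r) (u : V) :
    IsInitial (fun v w => r (.inr v) (.inr w)) fun w => z (.inl u) ⬝ᵥ z (.inr w) := by
  intro i j hij hj
  rw [h.dotProduct_eq_one_iff] at hj ⊢
  exact trans_of r hij hj

/-- Unless there is an orthonormal or a hyperbolic pair to project along, the inversion acts on
`D₁` like the inversion of the set of odd vertices. -/
theorem IsOrderedBy.trichotomy (h : (D₁.dijoin D₂).IsOrderedBy (fun u v => z u ⬝ᵥ z v) r) :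
    D₂.inv + 2 ≤ Fintype.card ι ∨ (∃ k, k + 1 = Fintype.card ι ∧ D₂.HasEvenDecycling k) ∨
      ∀ u v, z (.inl u) ⬝ᵥ z (.inl v) =
        (z (.inl u) ⬝ᵥ z (.inl u)) * (z (.inl v) ⬝ᵥ z (.inl v)) := by
  have := isStrictTotalOrder_comap (Sum.inr_injective (α := V) (β := W)) r
  rw [← or_assoc, or_iff_not_imp_left, not_or]
  rintro ⟨hn, hn'⟩ u v
  have hr := h.right
  have hu := h.isInitial u
  have hv := h.isInitial v
  rcases zmod_two_cases (z (.inl u) ⬝ᵥ z (.inl u)) with eu | eu <;>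
    rcases zmod_two_cases (z (.inl v) ⬝ᵥ z (.inl v)) with ev | ev <;>
    rcases zmod_two_cases (z (.inl u) ⬝ᵥ z (.inl v)) with e | e <;>
    simp only [eu, ev, e, mul_zero, mul_one]
  · exact absurd (inv_add_two_le_of_even_pair hr hu hv eu ev e) hn
  · exact ((inv_or_hasEvenDecycling_of_odd_even hr hv hu ev eu
      ((dotProduct_comm _ _).trans e)).elim hn hn').elim
  · exact ((inv_or_hasEvenDecycling_of_odd_even hr hu hv eu ev e).elim hn hn').elim
  · exact ((inv_or_hasEvenDecycling_of_odd_odd hr hu hv eu ev e).elim hn hn').elim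

theorem inv_le_one_of_gram {V : Type*} {D : OrientedGraph V} {c : V → ZMod 2} {s : V → V → Prop}
    [IsStrictTotalOrder V s] (h : D.IsOrderedBy (fun u v => c u * c v) s) : D.inv ≤ 1 := by
  have h' : D.IsOrderedBy (fun u v => (fun _ : Unit => c u) ⬝ᵥ fun _ : Unit => c v) s :=
    h.of_gram_eq (z := fun u _ => c u) fun u v => by simp [dotProduct]
  simpa using h'.inv_le

end Dijoin

/-! ### Bounds for the dijoin and the triangle -/

section Bounds

variable {V W : Type*} {D₁ : OrientedGraph V} {D₂ : OrientedGraph W}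

theorem HasEvenDecycling.inv_le {k : ℕ} (h : D₂.HasEvenDecycling k) : D₂.inv ≤ k := by
  obtain ⟨-, κ, _, y, r, rfl, _, hy, -⟩ := h
  exact hy.inv_le

/-- Orders of the two sides of a dijoin combine to an order of the dijoin if vectors of different
sides are orthogonal. -/
theorem inv_dijoin_le_card {κ : Type*} [Fintype κ] {x : V → κ → ZMod 2} {y : W → κ → ZMod 2}
    {r : V → V → Prop} {s : W → W → Prop} [IsStrictTotalOrder V r] [IsStrictTotalOrder W s]
    (hx : D₁.IsOrderedBy (fun u v => x u ⬝ᵥ x v) r) (hy : D₂.IsOrderedBy (fun u v => y u ⬝ᵥ y v) s)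
    (hxy : ∀ u w, x u ⬝ᵥ y w = 0) : (D₁.dijoin D₂).inv ≤ Fintype.card κ := by
  refine inv_le_card _ (Sum.elim x y) (Sum.Lex r s) (irrefl_of _) (fun _ _ _ => trans_of _) ?_
  rintro (u | u) (v | v) huv
  · simpa using hx u v huv
  · simp [hxy]
  · exact huv.elim
  · simpa using hy u v huv

theorem inv_dijoin_le [Finite V] [Finite W] (D₁ : OrientedGraph V) (D₂ : OrientedGraph W) :
    (D₁.dijoin D₂).inv ≤ D₁.inv + D₂.inv := by
  obtain ⟨x, r, _, hx⟩ := D₁.exists_isStrictTotalOrder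
  obtain ⟨y, s, _, hy⟩ := D₂.exists_isStrictTotalOrder
  have := inv_dijoin_le_card
    (hx.of_gram_eq (z := fun u => Sum.elim (x u) (0 : Fin D₂.inv → ZMod 2)) fun u v => by
      simp [sumElim_dotProduct_sumElim])
    (hy.of_gram_eq (z := fun u => Sum.elim (0 : Fin D₁.inv → ZMod 2) (y u)) fun u v => by
      simp [sumElim_dotProduct_sumElim])
    fun u w => by simp [sumElim_dotProduct_sumElim]
  simpa using this

theorem le_inv_dijoin [Finite V] [Finite W] (D₁ : OrientedGraph V) (D₂ : OrientedGraph W) :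
    D₂.inv ≤ (D₁.dijoin D₂).inv := by
  obtain ⟨z, r, _, hz⟩ := (D₁.dijoin D₂).exists_isStrictTotalOrder
  have := isStrictTotalOrder_comap (Sum.inr_injective (α := V) (β := W)) r
  simpa using hz.right.inv_le

theorem one_dotProduct_one_of_odd {κ : Type*} [Fintype κ] (h : Odd (Fintype.card κ)) :
    (1 : κ → ZMod 2) ⬝ᵥ 1 = 1 := by
  rw [← ZMod.natCast_eq_one_iff_odd] at h
  simpa [dotProduct] using h

/-- The first set of `D₁` is carried by the all-ones vector of `κ`, the second by one new
coordinate. -/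
theorem HasEvenDecycling.inv_dijoin_le [Finite V] {k : ℕ} (h : D₂.HasEvenDecycling k)
    (h₁ : D₁.inv = 2) : (D₁.dijoin D₂).inv ≤ k + 1 := by
  obtain ⟨ho, κ, _, y, s, rfl, _, hy, he⟩ := h
  have hone : (1 : κ → ZMod 2) ⬝ᵥ 1 = 1 := one_dotProduct_one_of_odd ho
  have hD := D₁.exists_isStrictTotalOrder
  rw [h₁] at hD
  obtain ⟨x, r, _, hx⟩ := hD
  have := inv_dijoin_le_card
    (hx.of_gram_eq (z := fun u => Sum.elim (x u 0 • (1 : κ → ZMod 2)) fun _ : Unit => x u 1)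
      fun u v => by
        rw [sumElim_dotProduct_sumElim, smul_dotProduct, dotProduct_smul, hone]
        simp [dotProduct])
    (hy.of_gram_eq (z := fun w => Sum.elim (y w) (0 : Unit → ZMod 2)) fun v w => by
      simp [sumElim_dotProduct_sumElim])
    fun u w => by
      rw [sumElim_dotProduct_sumElim, smul_dotProduct, dotProduct_comm,
        ← dotProduct_self_eq_dotProduct_one, he]
      simp
  simpa using this

theorem HasEvenDecycling.inv_directedTriangle_dijoin_le {k : ℕ} (h : D₂.HasEvenDecycling k) :
    (directedTriangle.dijoin D₂).inv ≤ k := by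
  obtain ⟨ho, κ, _, y, s, rfl, _, hy, he⟩ := h
  have hone : (1 : κ → ZMod 2) ⬝ᵥ 1 = 1 := one_dotProduct_one_of_odd ho
  -- Adding 2 yields the order 1, 2, 0, which suits the triangle after inversion of `{0, 1}`.
  have := isStrictTotalOrder_comap (add_left_injective (2 : Fin 3)) (· < ·)
  refine inv_dijoin_le_card (r := fun i j => i + 2 < j + 2) (x := ![1, 1, 0]) ?_ hy fun i w => ?_
  · intro i j hij
    change j = i + 1 at hij
    subst hij
    fin_cases i <;> simp [hone]
  · have h0 : (1 : κ → ZMod 2) ⬝ᵥ y w = 0 := by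
      rw [dotProduct_comm, ← dotProduct_self_eq_dotProduct_one, he]
    fin_cases i <;> simp [h0]

theorem hasEvenDecycling_of_inv_dijoin_le [Finite V] [Finite W] (h₁ : D₁.inv = 2)
    (h : (D₁.dijoin D₂).inv ≤ D₂.inv + 1) :
    (D₁.dijoin D₂).inv = D₂.inv + 1 ∧ D₂.HasEvenDecycling D₂.inv := by
  obtain ⟨z, r, _, hz⟩ := (D₁.dijoin D₂).exists_isStrictTotalOrder
  rcases hz.trichotomy with hc | ⟨k, hk, he⟩ | hc
  · rw [Fintype.card_fin] at hc
    omega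
  · rw [Fintype.card_fin] at hk
    have := he.inv_le
    obtain rfl : k = D₂.inv := by omega
    exact ⟨hk.symm, he⟩
  · have := isStrictTotalOrder_comap (Sum.inl_injective (α := V) (β := W)) r
    have hl := hz.left
    rw [show (fun u v => z (.inl u) ⬝ᵥ z (.inl v)) = _ from funext₂ hc] at hl
    have := inv_le_one_of_gram (c := fun u => z (.inl u) ⬝ᵥ z (.inl u)) hl
    omega

/-- Inverting at most one vertex keeps the cycle and inverting all three reverses it. So exactly two
are inverted, and the third ends up between them. -/
theorem IsOrderedBy.exists_directedTriangle {q : Fin 3 → ZMod 2} {s : Fin 3 → Fin 3 → Prop}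
    [IsStrictTotalOrder (Fin 3) s] (h : directedTriangle.IsOrderedBy (fun i j => q i * q j) s) :
    ∃ a b c, q a = 1 ∧ q b = 1 ∧ q c = 0 ∧ s a c ∧ s c b := by
  have hi : ¬ s 0 0 := irrefl_of s 0
  have ht : s 0 1 → s 1 2 → s 2 0 → s 0 0 := fun h h' h'' => trans_of s (trans_of s h h') h''
  have ht' : s 0 2 → s 2 1 → s 1 0 → s 0 0 := fun h h' h'' => trans_of s (trans_of s h h') h''
  have h0 := h 0 1 rfl
  have h1 := h 1 2 rfl
  have h2 := h 2 0 rfl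
  beta_reduce at h0 h1 h2
  rcases zmod_two_cases (q 0) with e0 | e0 <;> rcases zmod_two_cases (q 1) with e1 | e1 <;>
    rcases zmod_two_cases (q 2) with e2 | e2 <;>
    simp only [e0, e1, e2, mul_zero, mul_one, zero_ne_one, one_ne_zero, forall_const,
      false_imp_iff, and_true, true_and] at h0 h1 h2
  · exact absurd (ht h0 h1 h2) hi
  · exact absurd (ht h0 h1 h2) hi
  · exact absurd (ht h0 h1 h2) hi
  · exact ⟨2, 1, 0, e2, e1, e0, h2, h0⟩
  · exact absurd (ht h0 h1 h2) hi
  · exact ⟨0, 2, 1, e0, e2, e1, h0, h1⟩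
  · exact ⟨1, 0, 2, e1, e0, e2, h1, h2⟩
  · exact absurd (ht' h2 h1 h0) hi

/-- No coordinate can be saved here, so odd triangle vertices have the all-ones vector. The even one
lies between them and cuts `D₂` at the same place; minimality then forces its vector to be 0, so the
all-ones vector is orthogonal to `D₂`. -/
theorem hasEvenDecycling_of_inv_directedTriangle_dijoin [Finite W]
    (h : (directedTriangle.dijoin D₂).inv = D₂.inv) : D₂.HasEvenDecycling D₂.inv := by
  obtain ⟨z, r, _, hz⟩ := (directedTriangle.dijoin D₂).exists_isStrictTotalOrder
  have hcard : Fintype.card (Fin (directedTriangle.dijoin D₂).inv) = D₂.inv := by simp [h]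
  have := isStrictTotalOrder_comap (Sum.inl_injective (α := Fin 3) (β := W)) r
  have := isStrictTotalOrder_comap (Sum.inr_injective (α := Fin 3) (β := W)) r
  rcases hz.trichotomy with hc | ⟨k, hk, he⟩ | hc
  · omega
  · have := he.inv_le
    omega
  have hl := hz.left
  rw [show (fun u v => z (.inl u) ⬝ᵥ z (.inl v)) = _ from funext₂ hc] at hl
  obtain ⟨a, b, c, ha, hb, hc0, hac, hcb⟩ := hl.exists_directedTriangle
  have hone : ∀ u, z (.inl u) ⬝ᵥ z (.inl u) = 1 → z (.inl u) = 1 := by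
    intro u hu
    by_contra hu1
    have := inv_lt_card_of_odd hz.right (hz.isInitial u) hu hu1
    omega
  have ea := hone a ha
  have eb := hone b hb
  have h11 : (1 : Fin (directedTriangle.dijoin D₂).inv → ZMod 2) ⬝ᵥ 1 = 1 := by rwa [ea] at ha
  have hca : z (.inl c) ⬝ᵥ 1 = 0 := by rw [← dotProduct_self_eq_dotProduct_one, hc0]
  have hw : ∀ w, z (.inl c) ⬝ᵥ z (.inr w) = 1 ⬝ᵥ z (.inr w) := by
    intro w
    have ka := hz.dotProduct_eq_one_iff a w
    have kb := hz.dotProduct_eq_one_iff b w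
    have kc := hz.dotProduct_eq_one_iff c w
    rw [ea] at ka
    rw [eb] at kb
    rcases zmod_two_cases (1 ⬝ᵥ z (.inr w)) with e | e
    · rw [e]
      refine (zmod_two_cases _).resolve_right fun e' => ?_
      rw [kb.2 (trans_of r (kc.1 e') hcb)] at e
      exact one_ne_zero e
    · rw [e, kc]
      exact trans_of r (ka.1 e) hac
  -- This vector is odd and orthogonal to all of `D₂`; if it were not all-ones, a coordinate could
  -- be deleted.
  have hz1 : z (.inl c) + 1 = 1 := by
    by_contra hne
    have := inv_lt_card_of_orthogonal (a := z (.inl c) + 1) hz.right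
      (by simp [hc0, hca, dotProduct_comm 1, h11]) hne fun w => by
        rw [dotProduct_comm, add_dotProduct, hw, zmod_two_add_self]
    omega
  have hc00 : z (.inl c) = 0 := by simpa using hz1
  refine ⟨?_, _, inferInstance, fun w => z (.inr w), _, hcard, inferInstance, hz.right, fun w => ?_⟩
  · rw [← ZMod.natCast_eq_one_iff_odd, ← h, ← h11]
    simp [dotProduct]
  · rw [dotProduct_self_eq_dotProduct_one, dotProduct_comm, ← hw, hc00, zero_dotProduct]

end Bounds
end OrientedGraph

theorem theorem1p1 {V W : Type*} [Finite V] [Finite W]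
    (D₁ : OrientedGraph V) (D₂ : OrientedGraph W) (k : ℕ)
    (h₁ : D₁.inv = 2) (h₂ : D₂.inv = k) :
    ((D₁.dijoin D₂).inv = k + 2 ∨ ((D₁.dijoin D₂).inv = k + 1 ∧ Odd k)) ∧
    ((D₁.dijoin D₂).inv = k + 1 ↔ (OrientedGraph.directedTriangle.dijoin D₂).inv = k) ∧
    (Even k → (D₁.dijoin D₂).inv = D₁.inv + D₂.inv) := by
  subst h₂
  have hle := OrientedGraph.inv_dijoin_le D₁ D₂
  have main : (D₁.dijoin D₂).inv = D₂.inv + 2 ∨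
      ((D₁.dijoin D₂).inv = D₂.inv + 1 ∧ D₂.HasEvenDecycling D₂.inv) := by
    by_cases h : (D₁.dijoin D₂).inv ≤ D₂.inv + 1
    · exact Or.inr (OrientedGraph.hasEvenDecycling_of_inv_dijoin_le h₁ h)
    · exact Or.inl (by omega)
  refine ⟨main.imp_right fun h => ⟨h.1, h.2.1⟩, ⟨fun h => ?_, fun h => ?_⟩, fun hk => ?_⟩
  · obtain ⟨-, he⟩ := OrientedGraph.hasEvenDecycling_of_inv_dijoin_le h₁ h.le
    exact he.inv_directedTriangle_dijoin_le.antisymm (OrientedGraph.le_inv_dijoin _ _)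
  · have he := OrientedGraph.hasEvenDecycling_of_inv_directedTriangle_dijoin h
    exact (OrientedGraph.hasEvenDecycling_of_inv_dijoin_le h₁ (he.inv_dijoin_le h₁)).1
  · rcases main with h | ⟨-, ho, -⟩
    · omega
    · exact absurd hk (Nat.not_even_iff_odd.2 ho)
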